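/- **Conventions.** A *Young function* is a continuous, even, convex function $\Phi:\mathbb R\to\mathbb R$ with $\Phi(x)=0$ iff $x=0$, $\Phi(x)\to\infty$ and $\Phi(x)/x\to\infty$ as $x\to\infty$. Its complementary function is $\Phi^*(y)=\sup\{x|y|-\Phi(x):x\ge 0\}$. For functions on $[0,\infty)$ (extended evenly to $\mathbb R$): $\Phi\in\Delta'$ (globally) means that for some $c>0$, $\Phi(xy)\le c\,\Phi(x)\Phi(y)$ for all $x,y\ge0$; $\Phi\in\nabla'$ (globally) means that for some $b>0$, $\Phi(bxy)\ge\Phi(x)\Phi(y)$ for all $x,y\ge0$; $\Phi\preceq\Theta$ (globally) means that for some $a\ge0$, $\Phi(x)\le\Theta(ax)$ for all $x\ge0$. $\Phi^{-1}$ denotes the inverse of a Young function $\Phi$ on $[0,\infty)$. Let $(\Omega,\Sigma,\mu)$ be a $\sigma$-finite measure space and $\mathcal A\subseteq\Sigma$ a sub-$\sigma$-algebra such that $\mu|_{\mathcal A}$ is $\sigma$-finite; let $E$ be the conditional expectation with respect to $\mathcal A$, defined for every $\Sigma$-measurable $g\ge0$ (with values in $[0,\infty]$) and for every $\Sigma$-measurable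 complex $g$ that is *conditionable*, i.e. $E(|g|)<\infty$ a.e. An $\mathcal A$-atom is a set $A\in\mathcal A$ with $\mu(A)>0$ such that each $F\in\mathcal A$ with $F\subseteq A$ has $\mu(F)=0$ or $\mu(F)=\mu(A)$. Write $\Omega=\bigcup_n A_n\cup B$, where $(A_n)$ is a countable (possibly finite or empty) family of pairwise disjoint $\mathcal A$-atoms and $B\in\mathcal A$ is disjoint from all $A_n$ and contains no $\mathcal A$-atom. An $\mathcal A$-measurable function $g$ is a.e. constant on $A_n$; this constant is written $g(A_n)$. For a Young function $\Phi$, $L^\Phi(\Sigma)$ is the space of $\Sigma$-measurable $f:\Omega\to\mathbb C$ with $\int_\Omega\Phi(k|f|)\,d\mu<\infty$ for some $k>0$, with $N_\Phi(f)=\inf\{k>0:\int_\Omega\Phi(|f|/k)\,d\mu\le1\}$. For a $\Sigma$-measurable $u:\Omega\to\mathbb C$ put $\Phi^*(\bar u)=\Phi^*(|\bar u|)$ and $R_uf=E(uf)$. We say that $R_u$ *is bounded from $L^\Phi(\Sigma)$ into $L^\Psi(\Sigma)$* if for every $f\in L^\Phi(\Sigma)$ the function $uf$ is conditionable and $E(uf)\in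 L^\Psi(\Sigma)$, and there is $C<\infty$ with $N_\Psi(E(uf))\le C\,N_\Phi(f)$ for all $f\in L^\Phi(\Sigma)$. **Theorem 2.3.** Let $\Phi,\Psi$ be Young functions whose complementary functions $\Phi^*,\Psi^*$ are also Young functions, and let $u$ be $\Sigma$-measurable. (a) Assume that $\Phi^*\circ\Psi^{*-1}\preceq\Theta$ globally for some Young function $\Theta$, that $\Phi^*\in\Delta'$ globally, and that $E(\Phi^*(\bar u))=0$ a.e. on $B$. - If $\Theta\in\nabla'$ globally and $$\sup_n\frac{E(\Phi^*(\bar u))(A_n)\,\mu(A_n)}{\Phi^*(\Psi^{*-1}(\mu(A_n)))}<\infty,$$ then $R_u$ is bounded from $L^\Phi(\Sigma)$ into $L^\Psi(\Sigma)$. - If $\Psi^{*-1}\in\Delta'$ globally and $$\sup_n E(\Phi^*(\bar u))(A_n)\,\mu(A_n)\,\Phi^*\!\left(\Psi^{*-1}\!\left(\tfrac1{\mu(A_n)}\right)\right)<\infty,$$ then $R_u$ is bounded from $L^\Phi(\Sigma)$ into $L^\Psi(\Sigma)$. (b) Conversely, if $\Phi^*\circ\Psi^{*-1}$ is a Young function,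 $\Phi^*\in\nabla'$ globally, and $R_u$ is bounded from $L^\Phi(\Sigma)$ into $L^\Psi(\Sigma)$, then $E(\Phi^*(\bar u))=0$ a.e. on $B$, and $$\sup_n E(\Phi^*(\bar u))(A_n)\,\mu(A_n)\,\Phi^*\!\left(\Psi^{*-1}\!\left(\tfrac1{\mu(A_n)}\right)\right)<\infty.$$ -/

import Mathlib

open MeasureTheory Filter Set
open scoped ENNReal NNReal

noncomputable section

namespace OrliczWCT

/-- A Young function: a continuous, even, convex function on the real line that vanishes exactly at
`0` and is superlinear at infinity. -/
structure IsYoung (Φ : ℝ → ℝ) : Prop where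
  continuous : Continuous Φ
  convexOn : ConvexOn ℝ univ Φ
  eq_zero_iff : ∀ x, Φ x = 0 ↔ x = 0
  even : ∀ x, Φ (-x) = Φ x
  tendsto_div : Tendsto (fun x => Φ x / x) atTop atTop
  tendsto : Tendsto Φ atTop atTop

/-- The complementary function `Φ*(y) = sup {x |y| - Φ x : x ≥ 0}`. -/
def youngCompl (Φ : ℝ → ℝ) (y : ℝ) : ℝ :=
  sSup {t : ℝ | ∃ x : ℝ, 0 ≤ x ∧ t = x * |y| - Φ x}

/-- The inverse on `[0, ∞)` of a Young function, extended to the real line as an even function.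
For `y ≥ 0` and a Young function `Φ` it is the unique `x ≥ 0` with `Φ x = y`. -/
def youngInv (Φ : ℝ → ℝ) (y : ℝ) : ℝ :=
  sSup {x : ℝ | 0 ≤ x ∧ Φ x ≤ |y|}

/-- The global `Δ'` condition. -/
def DeltaPrime (Φ : ℝ → ℝ) : Prop :=
  ∃ c : ℝ, 0 < c ∧ ∀ x y : ℝ, 0 ≤ x → 0 ≤ y → Φ (x * y) ≤ c * (Φ x * Φ y)

/-- The global `∇'` condition. -/
def NablaPrime (Φ : ℝ → ℝ) : Prop :=
  ∃ b : ℝ, 0 < b ∧ ∀ x y : ℝ, 0 ≤ x → 0 ≤ y → Φ x * Φ y ≤ Φ (b * x * y)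

/-- `Dominated Φ Θ` is the global relation `Φ ≼ Θ`: `Φ x ≤ Θ (a x)` for all `x ≥ 0`. -/
def Dominated (Φ Θ : ℝ → ℝ) : Prop :=
  ∃ a : ℝ, 0 ≤ a ∧ ∀ x : ℝ, 0 ≤ x → Φ x ≤ Θ (a * x)

section Spaces

variable {Ω : Type*} {mΩ : MeasurableSpace Ω}

/-- The modular `∫ Φ(k |f|) dμ`. -/
def modular (Φ : ℝ → ℝ) (μ : Measure Ω) (k : ℝ) (f : Ω → ℂ) : ℝ≥0∞ :=
  ∫⁻ x, ENNReal.ofReal (Φ (k * ‖f x‖)) ∂μ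

/-- The Orlicz space `L^Φ(Σ)` of measurable complex functions. -/
def orlicz (Φ : ℝ → ℝ) (μ : Measure Ω) : Set (Ω → ℂ) :=
  {f | Measurable f ∧ ∃ k : ℝ, 0 < k ∧ modular Φ μ k f < ∞}

/-- The Luxemburg norm `N_Φ(f) = inf {k > 0 : ∫ Φ(f / k) dμ ≤ 1}`, with value `∞` if there is no
such `k`. -/
def luxNorm (Φ : ℝ → ℝ) (μ : Measure Ω) (f : Ω → ℂ) : ℝ≥0∞ :=
  ⨅ (k : ℝ) (_ : 0 < k) (_ : modular Φ μ k⁻¹ f ≤ 1), ENNReal.ofReal k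

/-- `f` is conditionable with respect to `m`: `E(|f|)` is finite almost everywhere. -/
def Conditionable (m : MeasurableSpace Ω) (μ : Measure[mΩ] Ω) (f : Ω → ℂ) : Prop :=
  ∀ᵐ x ∂μ, condLExp m μ (fun y => ‖f y‖ₑ) x < ∞

/-- The conditional expectation of a real function, as the difference of the conditional
expectations of its positive and negative parts. -/
def condExpReal (m : MeasurableSpace Ω) (μ : Measure[mΩ] Ω) (g : Ω → ℝ) (x : Ω) : ℝ :=
  (condLExp m μ (fun y => ENNReal.ofReal (g y)) x).toReal -
    (condLExp m μ (fun y => ENNReal.ofReal (-g y)) x).toReal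

/-- The conditional expectation of a (conditionable) complex function. -/
def condExpComplex (m : MeasurableSpace Ω) (μ : Measure[mΩ] Ω) (f : Ω → ℂ) (x : Ω) : ℂ :=
  ⟨condExpReal m μ (fun y => (f y).re) x, condExpReal m μ (fun y => (f y).im) x⟩

/-- The weighted conditional type operator `R_u f = E(u f)`. -/
def wct (m : MeasurableSpace Ω) (μ : Measure[mΩ] Ω) (u f : Ω → ℂ) : Ω → ℂ :=
  condExpComplex m μ (fun x => u x * f x)

/-- `R_u` is a bounded operator from the whole of `L^Φ(Σ)` into `L^Ψ(Σ)`: for every `f` in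
`L^Φ(Σ)`, `u f` is conditionable and `E(u f)` lies in `L^Ψ(Σ)`, and
`N_Ψ(E(u f)) ≤ C N_Φ(f)` with a constant `C` independent of `f`. -/
def WCTBounded (Φ Ψ : ℝ → ℝ) (m : MeasurableSpace Ω) (μ : Measure[mΩ] Ω) (u : Ω → ℂ) : Prop :=
  (∀ f ∈ orlicz Φ μ, Conditionable m μ (fun x => u x * f x) ∧ wct m μ u f ∈ orlicz Ψ μ) ∧
    ∃ C : ℝ≥0, ∀ f ∈ orlicz Φ μ, luxNorm Ψ μ (wct m μ u f) ≤ C * luxNorm Φ μ f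

/-- `E(Φ(ū))`, as a function with values in `[0, ∞]`. -/
def condModular (Φ : ℝ → ℝ) (m : MeasurableSpace Ω) (μ : Measure[mΩ] Ω) (u : Ω → ℂ) : Ω → ℝ≥0∞ :=
  condLExp m μ (fun x => ENNReal.ofReal (Φ ‖(starRingEnd ℂ) (u x)‖))

/-- An `m`-atom of `μ`. -/
def IsAtomOf (m : MeasurableSpace Ω) (μ : Measure[mΩ] Ω) (A : Set Ω) : Prop :=
  MeasurableSet[m] A ∧ 0 < μ A ∧
    ∀ F : Set Ω, MeasurableSet[m] F → F ⊆ A → μ F = 0 ∨ μ F = μ A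

/-- A decomposition of `Ω` into countably many pairwise disjoint `m`-atoms `A i` and a disjoint
set `B` in `m` that contains no `m`-atom. -/
structure IsAtomicDecomposition {ι : Type*} (m : MeasurableSpace Ω) (μ : Measure[mΩ] Ω)
    (A : ι → Set Ω) (B : Set Ω) : Prop where
  isAtom : ∀ i, IsAtomOf m μ (A i)
  pairwise_disjoint : Pairwise fun i j => Disjoint (A i) (A j)
  measurableSet : MeasurableSet[m] B
  disjoint : ∀ i, Disjoint (A i) B
  nonatomic : ∀ F : Set Ω, F ⊆ B → ¬ IsAtomOf m μ F
  union_eq : (⋃ i, A i) ∪ B = univ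

/-- The value `g(A)` of an `m`-measurable function `g ≥ 0` on an `m`-atom `A` of finite measure:
`g` is almost everywhere constant on `A`, and that constant is the average of `g` over `A`. -/
def atomValue (μ : Measure Ω) (g : Ω → ℝ≥0∞) (A : Set Ω) : ℝ≥0∞ :=
  ⨍⁻ x in A, g x ∂μ

end Spaces

end OrliczWCT

end

open OrliczWCT

/-!
The operator `R_u` is dual to multiplication by `u`, as a map from the `m`-measurable functions of
`L^{Ψ*}` to `L^{Φ*}`, and both directions estimate the modular `∫ Φ*(|u| Y)` for `m`-measurable `Y`.
No dual spaces are needed: the pairing of `u f` with `Y` is estimated by Young's inequality on one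
side and evaluated by its equality case on the other.

Sufficiency (`wctBounded_of_atom_le`). The vanishing of `E(Φ*(u))` on `B` forces `u = 0` there, while
`E(|u f|)` is constant on each atom `A i`, so only step functions `Y = ∑ z i 1_{A i}` matter. By `Δ'`,
`∫ Φ*(|u| Y) ≤ c ∑ J i Φ*(z i)` with `J i = ∫_{A i} Φ*(|u|)`, and each of the two growth conditions
gives `J i Φ*(z i) ≤ D μ(A i) Ψ*(z i)` whenever `μ(A i) Ψ*(z i) ≤ 1`. Hence the pairing is bounded on
the unit ball of `Ψ*`, and `sum_mul_le_one_of_pairing` turns this into a bound on the modular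
`∫ Ψ(|E(u f)| / C)`.

Necessity (`WCTBounded.exists_setLIntegral_le`). For `A` in `m` let `f` be `g(|u| y / C)` times the
conjugate phase of `u`, where `g` selects the maximizer in the definition of `Φ*`; any such selection
is monotone, hence measurable. Boundedness of `R_u`, tested on truncations of `f`, yields
`∫_A Φ*(|u| y / C) ≤ 1` as soon as `Ψ*(y) μ(A) ≤ 1`. The condition `∇'` pulls `y` out of the integral:
`∫_A Φ*(|u|) ≤ D / K(1 / μ(A))` with `K = Φ* ∘ Ψ*⁻¹`. On atoms this is the asserted bound. On `B` there
are sets of arbitrarily small positive measure inside any set of positive measure, and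
`K(t) / t → ∞` then forces the density `E(Φ*(u))` to vanish.
-/

namespace OrliczWCT

/-! ### Young functions, their complements and their inverses -/

lemma youngCompl_eq {Φ : ℝ → ℝ} {x y : ℝ} (hx : 0 ≤ x) (hy : 0 ≤ y)
    (hmax : ∀ z, 0 ≤ z → z * y - Φ z ≤ x * y - Φ x) : youngCompl Φ y = x * y - Φ x := by
  rw [youngCompl, abs_of_nonneg hy]
  refine IsGreatest.csSup_eq ⟨⟨x, hx, rfl⟩, ?_⟩
  rintro _ ⟨z, hz, rfl⟩
  exact hmax z hz

namespace IsYoung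

variable {Φ : ℝ → ℝ}

lemma map_zero (h : IsYoung Φ) : Φ 0 = 0 := (h.eq_zero_iff 0).2 rfl

lemma nonneg (h : IsYoung Φ) (x : ℝ) : 0 ≤ Φ x := by
  have h1 := h.convexOn.2 (mem_univ x) (mem_univ (-x)) 
    (by norm_num : (0 : ℝ) ≤ 1 / 2) (by norm_num : (0 : ℝ) ≤ 1 / 2) (by norm_num)
  simp only [smul_eq_mul, h.even] at h1
  have h2 : (1 / 2 : ℝ) * x + 1 / 2 * -x = 0 := by ring
  rw [h2, h.map_zero] at h1
  linarith

lemma pos (h : IsYoung Φ) {x : ℝ} (hx : x ≠ 0) : 0 < Φ x :=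
  (h.nonneg x).lt_of_ne fun h0 => hx ((h.eq_zero_iff x).1 h0.symm)

lemma map_mul_le (h : IsYoung Φ) {t : ℝ} (ht : 0 ≤ t) (ht1 : t ≤ 1) (x : ℝ) :
    Φ (t * x) ≤ t * Φ x := by
  have h1 := h.convexOn.2 (mem_univ x) (mem_univ 0) ht (sub_nonneg.2 ht1) (by ring)
  simpa [h.map_zero] using h1

lemma strictMonoOn (h : IsYoung Φ) : StrictMonoOn Φ (Ici 0) := by
  intro x hx y hy hxy
  have hx : 0 ≤ x := hx
  have hy0 : 0 < y := hx.trans_lt hxy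
  have h1 := h.map_mul_le (t := x / y) (by positivity) ((div_le_one hy0).2 hxy.le) y
  rw [div_mul_cancel₀ _ hy0.ne'] at h1
  have h2 : x / y < 1 := (div_lt_one hy0).2 hxy
  have h3 := h.pos hy0.ne'
  nlinarith

lemma mono (h : IsYoung Φ) {x y : ℝ} (hx : 0 ≤ x) (hxy : x ≤ y) : Φ x ≤ Φ y :=
  h.strictMonoOn.monotoneOn hx (hx.trans hxy : 0 ≤ y) hxy

lemma exists_eq (h : IsYoung Φ) {y : ℝ} (hy : 0 ≤ y) : ∃ x, 0 ≤ x ∧ Φ x = y := by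
  obtain ⟨b, hb0, hb⟩ := ((eventually_ge_atTop 0).and (h.tendsto.eventually_ge_atTop y)).exists
  obtain ⟨x, hx, hxy⟩ := intermediate_value_Icc hb0 h.continuous.continuousOn
    (show y ∈ Icc (Φ 0) (Φ b) from ⟨by rwa [h.map_zero], hb⟩)
  exact ⟨x, hx.1, hxy⟩

lemma youngInv_apply (h : IsYoung Φ) {x : ℝ} (hx : 0 ≤ x) : youngInv Φ (Φ x) = x := by
  have : {z : ℝ | 0 ≤ z ∧ Φ z ≤ |Φ x|} = Icc 0 x := by
    ext z
    rw [abs_of_nonneg (h.nonneg x)]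
    refine and_congr_right fun hz => ?_
    exact h.strictMonoOn.le_iff_le hz hx
  rw [youngInv, this, csSup_Icc hx]

lemma youngInv_nonneg (h : IsYoung Φ) {y : ℝ} (hy : 0 ≤ y) : 0 ≤ youngInv Φ y := by
  obtain ⟨x, hx, rfl⟩ := h.exists_eq hy
  rwa [h.youngInv_apply hx]

lemma apply_youngInv (h : IsYoung Φ) {y : ℝ} (hy : 0 ≤ y) : Φ (youngInv Φ y) = y := by
  obtain ⟨x, hx, rfl⟩ := h.exists_eq hy
  rw [h.youngInv_apply hx]

lemma youngInv_pos (h : IsYoung Φ) {y : ℝ} (hy : 0 < y) : 0 < youngInv Φ y := by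
  refine (h.youngInv_nonneg hy.le).lt_of_ne fun h0 => hy.ne ?_
  rw [← h.apply_youngInv hy.le, ← h0, h.map_zero]

/-- The supremum defining the complementary function is attained: superlinearity confines the
maximization to a compact interval. -/
lemma exists_isMax (h : IsYoung Φ) (y : ℝ) :
    ∃ x, 0 ≤ x ∧ ∀ z, 0 ≤ z → z * y - Φ z ≤ x * y - Φ x := by
  obtain ⟨b, hb⟩ := eventually_atTop.1
    ((eventually_gt_atTop 0).and (h.tendsto_div.eventually_ge_atTop y))
  have hb0 : 0 < b := (hb b le_rfl).1
  have hc : Continuous fun x => x * y - Φ x := (continuous_id.mul continuous_const).sub h.continuous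
  obtain ⟨x, hx, hmax⟩ := (isCompact_Icc (a := 0) (b := b)).exists_isMaxOn
    (nonempty_Icc.2 hb0.le) hc.continuousOn
  refine ⟨x, hx.1, fun z hz => ?_⟩
  rcases le_total z b with hzb | hbz
  · exact hmax ⟨hz, hzb⟩
  · have h0 : (0 : ℝ) * y - Φ 0 ≤ x * y - Φ x := hmax ⟨le_rfl, hb0.le⟩
    obtain ⟨hz0, h1⟩ := hb z hbz
    rw [le_div_iff₀ hz0] at h1
    rw [h.map_zero] at h0
    linarith

/-- Young's inequality. -/
lemma mul_le_add (h : IsYoung Φ) {x y : ℝ} (hx : 0 ≤ x) (hy : 0 ≤ y) :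
    x * y ≤ Φ x + youngCompl Φ y := by
  obtain ⟨z, hz, hmax⟩ := h.exists_isMax y
  rw [youngCompl_eq hz hy hmax]
  linarith [hmax x hx]

/-- Equality case of Young's inequality for a given second argument. Any two maximizers are ordered
like their slopes, so an arbitrary selection is monotone, and thereby measurable. -/
lemma exists_monotone_eq (h : IsYoung Φ) :
    ∃ g : ℝ → ℝ, Monotone g ∧ (∀ y, 0 ≤ g y) ∧
      ∀ y, 0 ≤ y → Φ (g y) + youngCompl Φ y = g y * y := by
  choose g hg hmax using h.exists_isMax
  refine ⟨g, fun y₁ y₂ hy => ?_, hg, fun y hy => ?_⟩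
  · rcases hy.eq_or_lt with rfl | hy
    · exact le_rfl
    have h1 := hmax y₁ (g y₂) (hg _)
    have h2 := hmax y₂ (g y₁) (hg _)
    nlinarith
  · rw [youngCompl_eq (hg y) hy (hmax y)]
    ring

/-- Equality case of Young's inequality for a given first argument: the second argument is a
subgradient. -/
lemma exists_add_le (h : IsYoung Φ) {x : ℝ} (hx : 0 ≤ x) :
    ∃ y, 0 ≤ y ∧ Φ x + youngCompl Φ y = x * y := by
  obtain ⟨y, hy⟩ : ∃ y, ∀ z, Φ x + y * (z - x) ≤ Φ z := by
    have hxi : x ∈ interior (univ : Set ℝ) := by simp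
    refine ⟨derivWithin Φ (Ioi x) x, fun z => ?_⟩
    rcases lt_trichotomy x z with hz | rfl | hz
    · have h1 := h.convexOn.rightDeriv_le_slope_of_mem_interior hxi (mem_univ z) hz
      rw [slope_def_field, le_div_iff₀ (sub_pos.2 hz)] at h1
      linarith
    · simp
    · have h1 := (h.convexOn.slope_le_leftDeriv_of_mem_interior (mem_univ z) hxi hz).trans
        (h.convexOn.leftDeriv_le_rightDeriv_of_mem_interior hxi)
      rw [slope_def_field, div_le_iff₀ (sub_pos.2 hz)] at h1
      linarith
  rcases hx.eq_or_lt with rfl | hx0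
  · refine ⟨0, le_rfl, ?_⟩
    rw [youngCompl_eq le_rfl le_rfl fun z _ => by simpa [h.map_zero] using h.nonneg z]
    ring
  · have hy0 : 0 ≤ y := by
      have h1 := hy 0
      rw [h.map_zero] at h1
      nlinarith [h.nonneg x]
    refine ⟨y, hy0, ?_⟩
    rw [youngCompl_eq hx hy0 fun z _ => by linarith [hy z]]
    ring

end IsYoung

/-! ### Modulars and Luxemburg norms -/

section Modular

variable {Ω : Type*} {mΩ : MeasurableSpace Ω} {μ : Measure Ω} {Φ : ℝ → ℝ} {f : Ω → ℂ}

lemma IsYoung.measurable_ofReal (h : IsYoung Φ) {g : Ω → ℝ} (hg : Measurable g) :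
    Measurable fun x => ENNReal.ofReal (Φ (g x)) :=
  (h.continuous.measurable.comp hg).ennreal_ofReal

lemma modular_mul_le (h : IsYoung Φ) {t : ℝ} (ht : 0 ≤ t) (ht1 : t ≤ 1) (k : ℝ) :
    modular Φ μ (t * k) f ≤ ENNReal.ofReal t * modular Φ μ k f := by
  rw [modular, modular, ← lintegral_const_mul' _ _ ENNReal.ofReal_ne_top]
  refine lintegral_mono fun x => ?_
  rw [← ENNReal.ofReal_mul ht, mul_assoc]
  exact ENNReal.ofReal_le_ofReal (h.map_mul_le ht ht1 _)

lemma modular_inv_max_le_one (h : IsYoung Φ) {k : ℝ} (hf : modular Φ μ k f ≠ ∞) :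
    modular Φ μ ((max 1 (modular Φ μ k f).toReal)⁻¹ * k) f ≤ 1 := by
  set σ := max 1 (modular Φ μ k f).toReal
  have hσ : 1 ≤ σ := le_max_left _ _
  have hσ0 : 0 < σ := one_pos.trans_le hσ
  refine (modular_mul_le h (inv_nonneg.2 hσ0.le) (inv_le_one_of_one_le₀ hσ) k).trans ?_
  rw [← ENNReal.ofReal_toReal hf, ← ENNReal.ofReal_mul (inv_nonneg.2 hσ0.le), ← ENNReal.ofReal_one]
  refine ENNReal.ofReal_le_ofReal ?_
  rw [inv_mul_le_one₀ hσ0]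
  exact le_max_right _ _

lemma exists_modular_inv_le_one (h : IsYoung Φ) (hf : f ∈ orlicz Φ μ) :
    ∃ k : ℝ, 0 < k ∧ modular Φ μ k⁻¹ f ≤ 1 := by
  obtain ⟨-, k, hk, hfin⟩ := hf
  have hσ : 0 < max 1 (modular Φ μ k f).toReal := lt_max_of_lt_left one_pos
  refine ⟨((max 1 (modular Φ μ k f).toReal)⁻¹ * k)⁻¹, by positivity, ?_⟩
  rw [inv_inv]
  exact modular_inv_max_le_one h hfin.ne

lemma luxNorm_le {k : ℝ} (hk : 0 < k) (hf : modular Φ μ k⁻¹ f ≤ 1) :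
    luxNorm Φ μ f ≤ ENNReal.ofReal k :=
  iInf_le_of_le k (iInf_le_of_le hk (iInf_le _ hf))

lemma exists_of_luxNorm_lt {r : ℝ≥0∞} (hr : luxNorm Φ μ f < r) :
    ∃ k : ℝ, 0 < k ∧ modular Φ μ k⁻¹ f ≤ 1 ∧ ENNReal.ofReal k < r := by
  simp only [luxNorm, iInf_lt_iff] at hr
  obtain ⟨k, hk, hf, hlt⟩ := hr
  exact ⟨k, hk, hf, hlt⟩

end Modular

/-! ### Conditional expectations and atoms -/

section CondExp

variable {Ω : Type*} {m mΩ : MeasurableSpace Ω} {μ : Measure Ω} {Φ : ℝ → ℝ} {u : Ω → ℂ}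

lemma measurable_wct (u f : Ω → ℂ) : Measurable (wct m μ u f) := by
  have h : ∀ g : Ω → ℝ, Measurable (condExpReal m μ g) := fun g =>
    (measurable_condLExp' _ _ _).ennreal_toReal.sub (measurable_condLExp' _ _ _).ennreal_toReal
  exact Complex.measurableEquivRealProd.symm.measurable.comp ((h _).prodMk (h _))

lemma abs_condExpReal_le {g : Ω → ℝ} {G : Ω → ℝ≥0∞} (hg : ∀ x, ENNReal.ofReal |g x| ≤ G x)
    (hG : ∀ᵐ x ∂μ, condLExp m μ G x < ∞) :
    ∀ᵐ x ∂μ, |condExpReal m μ g x| ≤ (condLExp m μ G x).toReal := by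
  have h1 : condLExp m μ (fun x => ENNReal.ofReal (g x)) ≤ᵐ[μ] condLExp m μ G :=
    condLExp_mono (ae_of_all _ fun x => (ENNReal.ofReal_le_ofReal (le_abs_self _)).trans (hg x))
  have h2 : condLExp m μ (fun x => ENNReal.ofReal (-g x)) ≤ᵐ[μ] condLExp m μ G :=
    condLExp_mono (ae_of_all _ fun x => (ENNReal.ofReal_le_ofReal (neg_le_abs _)).trans (hg x))
  filter_upwards [h1, h2, hG] with x h1 h2 hG
  exact abs_sub_le_of_nonneg_of_le ENNReal.toReal_nonneg (ENNReal.toReal_mono hG.ne h1)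
    ENNReal.toReal_nonneg (ENNReal.toReal_mono hG.ne h2)

lemma norm_wct_le {u f : Ω → ℂ} (h : Conditionable m μ fun x => u x * f x) :
    ∀ᵐ x ∂μ, ‖wct m μ u f x‖ ≤ 2 * (condLExp m μ (fun x => ‖u x * f x‖ₑ) x).toReal := by
  have h1 := abs_condExpReal_le (m := m) (μ := μ) (g := fun x => (u x * f x).re)
    (G := fun x => ‖u x * f x‖ₑ) (fun x => by
      rw [← ofReal_norm]
      exact ENNReal.ofReal_le_ofReal (Complex.abs_re_le_norm _)) h
  have h2 := abs_condExpReal_le (m := m) (μ := μ) (g := fun x => (u x * f x).im)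
    (G := fun x => ‖u x * f x‖ₑ) (fun x => by
      rw [← ofReal_norm]
      exact ENNReal.ofReal_le_ofReal (Complex.abs_im_le_norm _)) h
  filter_upwards [h1, h2] with x h1 h2
  refine (Complex.norm_le_abs_re_add_abs_im _).trans ?_
  rw [two_mul]
  exact add_le_add h1 h2

lemma norm_wct_of_nonneg {u f : Ω → ℂ} {g : Ω → ℝ} (hg : ∀ x, 0 ≤ g x)
    (h : ∀ x, u x * f x = g x) (x : Ω) :
    ‖wct m μ u f x‖ = (condLExp m μ (fun x => ‖u x * f x‖ₑ) x).toReal := by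
  have h0 : condLExp m μ (fun _ : Ω => (0 : ℝ≥0∞)) = 0 := condLExp_zero μ
  have h1 : (fun x => ENNReal.ofReal (-g x)) = fun _ => 0 := by
    ext x
    exact ENNReal.ofReal_of_nonpos (neg_nonpos.2 (hg x))
  have h2 : (fun x => ‖u x * f x‖ₑ) = fun x => ENNReal.ofReal (g x) := by
    ext x
    rw [h, ← ofReal_norm, Complex.norm_of_nonneg (hg x)]
  have h3 : wct m μ u f x = ((condLExp m μ (fun x => ‖u x * f x‖ₑ) x).toReal : ℂ) := by
    apply Complex.ext
    · rw [h2]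
      simp only [wct, condExpComplex, condExpReal, h, Complex.ofReal_re, h1, h0]
      simp
    · simp only [wct, condExpComplex, condExpReal, h, Complex.ofReal_im, neg_zero,
        ENNReal.ofReal_zero, h0]
      simp
  rw [h3, Complex.norm_of_nonneg ENNReal.toReal_nonneg]

/-- An atom meets one of the finite-measure sets that exhaust the space in a set of positive
measure, hence has finite measure. -/
lemma IsAtomOf.measure_lt_top {A : Set Ω} (hm : m ≤ mΩ) [SigmaFinite (μ.trim hm)]
    (h : IsAtomOf m μ A) : μ A < ∞ := by
  obtain ⟨hA, hpos, hat⟩ := h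
  have hcov : A = ⋃ n, A ∩ spanningSets (μ.trim hm) n := by
    rw [← inter_iUnion, iUnion_spanningSets, inter_univ]
  obtain ⟨n, hn⟩ : ∃ n, μ (A ∩ spanningSets (μ.trim hm) n) ≠ 0 := by
    by_contra! hall
    rw [hcov, measure_iUnion_null hall] at hpos
    exact hpos.ne rfl
  have hS := measurableSet_spanningSets (μ.trim hm) n
  rw [← (hat _ (hA.inter hS) inter_subset_left).resolve_left hn]
  refine (measure_mono inter_subset_right).trans_lt ?_
  rw [← trim_measurableSet_eq hm hS]
  exact measure_spanningSets_lt_top _ n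

lemma IsAtomOf.exists_ae_eq_const {A : Set Ω} (hm : m ≤ mΩ) (h : IsAtomOf m μ A)
    (hfin : μ A ≠ ∞) {g : Ω → ℝ≥0∞} (hg : Measurable[m] g) :
    ∃ c, ∀ᵐ x ∂μ.restrict A, g x = c := by
  obtain ⟨hA, -, hat⟩ := h
  refine Filter.exists_eventuallyEq_const_of_forall_separating MeasurableSet fun U hU => ?_
  have hgU : MeasurableSet[m] (g ⁻¹' U) := hg hU
  rcases hat _ (hA.inter hgU) inter_subset_left with h0 | h1
  · right
    rw [ae_restrict_iff' (hm _ hA), ae_iff]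
    convert h0 using 2
    ext x
    simp
  · left
    rw [ae_restrict_iff' (hm _ hA), ae_iff]
    have h2 := measure_sdiff (μ := μ) inter_subset_left (hm _ (hA.inter hgU)).nullMeasurableSet
      (by rwa [h1])
    rw [h1, tsub_self] at h2
    convert h2 using 2
    ext x
    simp

lemma atomValue_mul_measure {A : Set Ω} (hfin : μ A ≠ ∞) (g : Ω → ℝ≥0∞) :
    atomValue μ g A * μ A = ∫⁻ x in A, g x ∂μ := by
  rw [atomValue, mul_comm]
  exact measure_mul_setLAverage _ hfin

lemma setLIntegral_condModular (hm : m ≤ mΩ) [SigmaFinite (μ.trim hm)] {A : Set Ω}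
    (hA : MeasurableSet[m] A) :
    ∫⁻ x in A, condModular Φ m μ u x ∂μ = ∫⁻ x in A, ENNReal.ofReal (Φ ‖u x‖) ∂μ := by
  rw [condModular, setLIntegral_condLExp hm μ _ hA]
  simp only [RCLike.norm_conj]

lemma IsAtomOf.atomValue_condModular_mul (hm : m ≤ mΩ) [SigmaFinite (μ.trim hm)] {A : Set Ω}
    (hA : IsAtomOf m μ A) :
    atomValue μ (condModular Φ m μ u) A * μ A = ∫⁻ x in A, ENNReal.ofReal (Φ ‖u x‖) ∂μ := by
  rw [atomValue_mul_measure (hA.measure_lt_top hm).ne, setLIntegral_condModular hm hA.1]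

end CondExp

/-! ### Sufficiency -/

section Sufficiency

variable {Ω : Type*} {m mΩ : MeasurableSpace Ω} {μ : Measure Ω} {Φ Ψ : ℝ → ℝ} {u : Ω → ℂ}

/-- It suffices to bound the modular on the unit ball, uniformly in the scale `k`, since the Luxemburg
norm is an infimum over such `k`. -/
lemma wctBounded_of_modular_le (hΦ : IsYoung Φ) {C : ℝ} (hC : 0 < C)
    (h : ∀ (f : Ω → ℂ) (k : ℝ), Measurable f → 0 < k → modular Φ μ k⁻¹ f ≤ 1 →
      Conditionable m μ (fun x => u x * f x) ∧ modular Ψ μ (C * k)⁻¹ (wct m μ u f) ≤ 1) :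
    WCTBounded Φ Ψ m μ u := by
  refine ⟨fun f hf => ?_, C.toNNReal, fun f hf => ?_⟩
  · obtain ⟨k, hk, hfk⟩ := exists_modular_inv_le_one hΦ hf
    obtain ⟨h1, h2⟩ := h f k hf.1 hk hfk
    exact ⟨h1, measurable_wct u f, (C * k)⁻¹, by positivity, h2.trans_lt ENNReal.one_lt_top⟩
  · have hC0 : (C.toNNReal : ℝ≥0∞) ≠ 0 := by simpa using hC
    rw [mul_comm, ← ENNReal.div_le_iff_le_mul (Or.inl hC0) (Or.inl ENNReal.coe_ne_top)]
    refine le_iInf fun k => le_iInf fun hk => le_iInf fun hfk => ?_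
    rw [ENNReal.div_le_iff_le_mul (Or.inl hC0) (Or.inl ENNReal.coe_ne_top)]
    refine (luxNorm_le (by positivity) (h f k hf.1 hk hfk).2).trans ?_
    rw [mul_comm, ENNReal.ofReal_mul hk.le]
    rfl

/-- Young's inequality for the product `u f`, integrated over a set. -/
lemma setLIntegral_mul_le (hΦ : IsYoung Φ) (hΦc : IsYoung (youngCompl Φ)) (hu : Measurable u)
    (f : Ω → ℂ) {k y : ℝ} (hk : 0 < k) (hy : 0 ≤ y) (S : Set Ω) :
    ENNReal.ofReal (y / k) * ∫⁻ x in S, ‖u x * f x‖ₑ ∂μ ≤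
      (∫⁻ x in S, ENNReal.ofReal (Φ (k⁻¹ * ‖f x‖)) ∂μ) +
        ∫⁻ x in S, ENNReal.ofReal (youngCompl Φ (‖u x‖ * y)) ∂μ := by
  rw [← lintegral_const_mul' _ _ ENNReal.ofReal_ne_top,
    ← lintegral_add_right _ (hΦc.measurable_ofReal (hu.norm.mul_const y))]
  refine lintegral_mono fun x => ?_
  rw [← ofReal_norm, norm_mul, ← ENNReal.ofReal_mul (by positivity),
    ← ENNReal.ofReal_add (hΦ.nonneg _) (hΦc.nonneg _)]
  refine ENNReal.ofReal_le_ofReal (le_trans (le_of_eq ?_)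
    (hΦ.mul_le_add (x := k⁻¹ * ‖f x‖) (y := ‖u x‖ * y) (by positivity) (by positivity)))
  ring

/-- A duality estimate for finite sums: if the pairing of `x` with every `z` in the unit ball of the
weighted modular of `Ψ*` is at most `1`, then `x` lies in the unit ball of the modular of `Ψ`.
One takes for `z i` the equality case of Young's inequality and normalizes. -/
lemma sum_mul_le_one_of_pairing {ι : Type*} (hΨ : IsYoung Ψ) (hΨc : IsYoung (youngCompl Ψ))
    (s : Finset ι) (w x : ι → ℝ) (hw : ∀ i, 0 ≤ w i) (hx : ∀ i, 0 ≤ x i)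
    (h : ∀ z : ι → ℝ, (∀ i, 0 ≤ z i) → ∑ i ∈ s, w i * youngCompl Ψ (z i) ≤ 1 →
      ∑ i ∈ s, w i * (x i * z i) ≤ 1) :
    ∑ i ∈ s, w i * Ψ (x i) ≤ 1 := by
  choose z hz0 hz using fun i => hΨ.exists_add_le (hx i)
  set T := ∑ i ∈ s, w i * youngCompl Ψ (z i) with hT
  set τ := max 1 T
  have hτ1 : 1 ≤ τ := le_max_left _ _
  have hτ : 0 < τ := one_pos.trans_le hτ1
  have hsum : ∑ i ∈ s, w i * youngCompl Ψ (τ⁻¹ * z i) ≤ 1 := by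
    have h1 : ∑ i ∈ s, w i * youngCompl Ψ (τ⁻¹ * z i) ≤ τ⁻¹ * T := by
      rw [hT, Finset.mul_sum]
      refine Finset.sum_le_sum fun i _ => ?_
      rw [mul_left_comm]
      exact mul_le_mul_of_nonneg_left
        (hΨc.map_mul_le (inv_nonneg.2 hτ.le) (inv_le_one_of_one_le₀ hτ1) _) (hw i)
    exact h1.trans ((inv_mul_le_one₀ hτ).2 (le_max_right _ _))
  have hp := h (fun i => τ⁻¹ * z i) (fun i => mul_nonneg (inv_nonneg.2 hτ.le) (hz0 i)) hsum
  have h2 : ∑ i ∈ s, w i * (x i * (τ⁻¹ * z i)) = τ⁻¹ * (∑ i ∈ s, w i * Ψ (x i) + T) := by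
    rw [hT, ← Finset.sum_add_distrib, Finset.mul_sum]
    refine Finset.sum_congr rfl fun i _ => ?_
    rw [← mul_add, hz]
    ring
  rw [h2, inv_mul_le_one₀ hτ] at hp
  rcases le_total T 1 with hT1 | hT1
  · have h3 : τ = 1 := max_eq_left hT1
    have h4 : 0 ≤ T := Finset.sum_nonneg fun i _ => mul_nonneg (hw i) (hΨc.nonneg _)
    linarith
  · have h3 : τ = T := max_eq_right hT1
    linarith

variable {ι : Type*} {A : ι → Set Ω} {B : Set Ω}

lemma IsAtomicDecomposition.lintegral_eq [Countable ι] (hm : m ≤ mΩ)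
    (hAB : IsAtomicDecomposition m μ A B) (g : Ω → ℝ≥0∞) :
    ∫⁻ x, g x ∂μ = ∑' i, ∫⁻ x in A i, g x ∂μ + ∫⁻ x in B, g x ∂μ := by
  rw [← setLIntegral_univ, ← hAB.union_eq, lintegral_union (hm _ hAB.measurableSet)
    (disjoint_iUnion_left.2 hAB.disjoint), lintegral_iUnion (fun i => hm _ (hAB.isAtom i).1)
    hAB.pairwise_disjoint]

lemma IsAtomicDecomposition.ae_of_restrict [Countable ι] (hm : m ≤ mΩ)
    (hAB : IsAtomicDecomposition m μ A B) {p : Ω → Prop}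
    (hA : ∀ i, ∀ᵐ x ∂μ.restrict (A i), p x) (hB : ∀ᵐ x ∂μ.restrict B, p x) : ∀ᵐ x ∂μ, p x := by
  have hA' : ∀ᵐ x ∂μ, ∀ i, x ∈ A i → p x :=
    ae_all_iff.2 fun i => (ae_restrict_iff' (hm _ (hAB.isAtom i).1)).1 (hA i)
  filter_upwards [hA', (ae_restrict_iff' (hm _ hAB.measurableSet)).1 hB] with x hxA hxB
  have hx : x ∈ (⋃ i, A i) ∪ B := hAB.union_eq ▸ mem_univ x
  rcases hx with hx | hx
  · obtain ⟨i, hi⟩ := mem_iUnion.1 hx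
    exact hxA i hi
  · exact hxB hx

/-- The sufficient condition in the form of an estimate on each atom: on the unit ball of the
modular of `Ψ*`, the modular of `y 1_{A i}` for `Φ*` with weight `E(Φ*(|u|))` is at most a constant
times its modular for `Ψ*`. -/
theorem wctBounded_of_atom_le [Countable ι] (hm : m ≤ mΩ) [SigmaFinite (μ.trim hm)]
    (hAB : IsAtomicDecomposition m μ A B) (hΦ : IsYoung Φ) (hΨ : IsYoung Ψ)
    (hΦc : IsYoung (youngCompl Φ)) (hΨc : IsYoung (youngCompl Ψ)) (hu : Measurable u)
    (hΔ : DeltaPrime (youngCompl Φ))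
    (hB : ∀ᵐ x ∂μ, x ∈ B → condModular (youngCompl Φ) m μ u x = 0) {D : ℝ} (hD : 0 ≤ D)
    (hA : ∀ i y, 0 ≤ y → (μ (A i)).toReal * youngCompl Ψ y ≤ 1 →
      (∫⁻ x in A i, ENNReal.ofReal (youngCompl Φ ‖u x‖) ∂μ) * ENNReal.ofReal (youngCompl Φ y) ≤
        ENNReal.ofReal (D * ((μ (A i)).toReal * youngCompl Ψ y))) :
    WCTBounded Φ Ψ m μ u := by
  obtain ⟨c, hc, hΔ⟩ := hΔ
  have hAfin : ∀ i, μ (A i) ≠ ∞ := fun i => ((hAB.isAtom i).measure_lt_top hm).ne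
  have hApos : ∀ i, 0 < (μ (A i)).toReal := fun i =>
    ENNReal.toReal_pos (hAB.isAtom i).2.1.ne' (hAfin i)
  have hmA : ∀ i, MeasurableSet (A i) := fun i => hm _ (hAB.isAtom i).1
  have hmB : MeasurableSet B := hm _ hAB.measurableSet
  have hmeas : Measurable fun x => ENNReal.ofReal (youngCompl Φ ‖u x‖) :=
    hΦc.measurable_ofReal hu.norm
  -- The weight is finite on every atom: test the hypothesis with one `y > 0`.
  have hJ : ∀ i, ∫⁻ x in A i, ENNReal.ofReal (youngCompl Φ ‖u x‖) ∂μ ≠ ∞ := by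
    intro i htop
    have hinv : 0 < (μ (A i)).toReal⁻¹ := inv_pos.2 (hApos i)
    have hy := hΨc.youngInv_pos hinv
    have h1 := hA i _ hy.le (by rw [hΨc.apply_youngInv hinv.le, mul_inv_cancel₀ (hApos i).ne'])
    rw [htop, ENNReal.top_mul (by simpa using hΦc.pos hy.ne'), top_le_iff] at h1
    exact ENNReal.ofReal_ne_top h1
  have hΔ' : ∀ i {y : ℝ}, 0 ≤ y →
      ∫⁻ x in A i, ENNReal.ofReal (youngCompl Φ (‖u x‖ * y)) ∂μ ≤
        ENNReal.ofReal c * ((∫⁻ x in A i, ENNReal.ofReal (youngCompl Φ ‖u x‖) ∂μ) *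
          ENNReal.ofReal (youngCompl Φ y)) := by
    intro i y hy
    rw [← lintegral_mul_const _ hmeas, ← lintegral_const_mul _ (hmeas.mul_const _)]
    refine lintegral_mono fun x => ?_
    rw [← ENNReal.ofReal_mul (hΦc.nonneg _), ← ENNReal.ofReal_mul hc.le]
    exact ENNReal.ofReal_le_ofReal (hΔ _ _ (norm_nonneg _) hy)
  have huB : ∀ᵐ x ∂μ.restrict B, u x = 0 := by
    have h1 : ∫⁻ x in B, ENNReal.ofReal (youngCompl Φ ‖u x‖) ∂μ = 0 := by
      rw [← setLIntegral_condModular hm hAB.measurableSet]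
      refine (lintegral_eq_zero_iff (measurable_condLExp' _ _ _)).2 ?_
      rw [EventuallyEq, ae_restrict_iff' hmB]
      filter_upwards [hB] with x hx hxB
      exact hx hxB
    filter_upwards [(lintegral_eq_zero_iff hmeas).1 h1] with x hx
    have h3 : youngCompl Φ ‖u x‖ = 0 :=
      le_antisymm (ENNReal.ofReal_eq_zero.1 hx) (hΦc.nonneg _)
    exact norm_eq_zero.1 ((hΦc.eq_zero_iff _).1 h3)
  have hC : 0 < 1 + c * D := by positivity
  refine wctBounded_of_modular_le (C := 2 * (1 + c * D)) hΦ (by positivity)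
    fun f k hf hk hfk => ?_
  set h := condLExp m μ fun x => ‖u x * f x‖ₑ with hh
  have hint : ∀ {S}, MeasurableSet[m] S → ∫⁻ x in S, h x ∂μ = ∫⁻ x in S, ‖u x * f x‖ₑ ∂μ :=
    fun hS => setLIntegral_condLExp hm μ _ hS
  have hle1 : ∀ S : Set Ω, ∫⁻ x in S, ENNReal.ofReal (Φ (k⁻¹ * ‖f x‖)) ∂μ ≤ 1 := fun S =>
    (setLIntegral_le_lintegral S _).trans hfk
  have hufin : ∀ i, ∫⁻ x in A i, ‖u x * f x‖ₑ ∂μ ≠ ∞ := by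
    intro i htop
    have h1 := setLIntegral_mul_le (μ := μ) hΦ hΦc hu f hk zero_le_one (A i)
    rw [htop, ENNReal.mul_top (by simpa using hk), top_le_iff] at h1
    refine ENNReal.add_ne_top.2 ⟨((hle1 _).trans_lt ENNReal.one_lt_top).ne, ?_⟩ h1
    simpa using hJ i
  choose a ha using fun i => (hAB.isAtom i).exists_ae_eq_const hm (hAfin i)
    (measurable_condLExp m μ fun x => ‖u x * f x‖ₑ)
  have haint : ∀ i, a i * μ (A i) = ∫⁻ x in A i, ‖u x * f x‖ₑ ∂μ := by
    intro i
    rw [← hint (hAB.isAtom i).1, lintegral_congr_ae (ha i), setLIntegral_const]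
  have hafin : ∀ i, a i ≠ ∞ := by
    intro i htop
    refine hufin i ?_
    rw [← haint, htop, ENNReal.top_mul (hAB.isAtom i).2.1.ne']
  have hhB : ∀ᵐ x ∂μ.restrict B, h x = 0 := by
    refine (lintegral_eq_zero_iff (measurable_condLExp' _ _ _)).1 ?_
    rw [hint hAB.measurableSet, lintegral_congr_ae (g := fun _ => 0), lintegral_zero]
    filter_upwards [huB] with x hx
    simp [hx]
  have hcond : Conditionable m μ fun x => u x * f x := by
    refine hAB.ae_of_restrict hm (fun i => ?_) ?_
    · filter_upwards [ha i] with x hx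
      rw [hx]
      exact (hafin i).lt_top
    · filter_upwards [hhB] with x hx
      rw [← hh, hx]
      exact ENNReal.zero_lt_top
  refine ⟨hcond, ?_⟩
  have hnorm := norm_wct_le hcond
  set X : ι → ℝ := fun i => ((1 + c * D) * k)⁻¹ * (a i).toReal with hX
  have hX0 : ∀ i, 0 ≤ X i := fun i => by positivity
  have hAi : ∀ i, ∫⁻ x in A i, ENNReal.ofReal (Ψ ((2 * (1 + c * D) * k)⁻¹ * ‖wct m μ u f x‖)) ∂μ ≤
      ENNReal.ofReal ((μ (A i)).toReal * Ψ (X i)) := by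
    intro i
    rw [ENNReal.ofReal_mul ENNReal.toReal_nonneg, ENNReal.ofReal_toReal (hAfin i),
      mul_comm (μ (A i)), ← setLIntegral_const]
    refine lintegral_mono_ae ?_
    filter_upwards [ha i, ae_restrict_of_ae hnorm] with x hx hn
    rw [hx] at hn
    refine ENNReal.ofReal_le_ofReal (hΨ.mono (by positivity) ?_)
    calc (2 * (1 + c * D) * k)⁻¹ * ‖wct m μ u f x‖
        ≤ (2 * (1 + c * D) * k)⁻¹ * (2 * (a i).toReal) := by gcongr
      _ = X i := by
        rw [hX]
        field_simp
  have hBi : ∫⁻ x in B, ENNReal.ofReal (Ψ ((2 * (1 + c * D) * k)⁻¹ * ‖wct m μ u f x‖)) ∂μ = 0 := by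
    rw [lintegral_congr_ae (g := fun _ => 0), lintegral_zero]
    filter_upwards [hhB, ae_restrict_of_ae hnorm] with x hx hn
    rw [← hh, hx, ENNReal.toReal_zero, mul_zero] at hn
    simp [norm_le_zero_iff.1 hn, hΨ.map_zero]
  rw [modular, hAB.lintegral_eq hm, hBi, add_zero]
  refine (ENNReal.tsum_le_tsum hAi).trans ?_
  rw [ENNReal.tsum_eq_iSup_sum]
  refine iSup_le fun s => ?_
  rw [← ENNReal.ofReal_sum_of_nonneg fun i _ => mul_nonneg ENNReal.toReal_nonneg (hΨ.nonneg _)]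
  rw [← ENNReal.ofReal_one]
  refine ENNReal.ofReal_le_ofReal (sum_mul_le_one_of_pairing hΨ hΨc s _ _
    (fun i => ENNReal.toReal_nonneg) hX0 fun z hz hz1 => ?_)
  have hz1' : ∀ i ∈ s, (μ (A i)).toReal * youngCompl Ψ (z i) ≤ 1 := fun i hi =>
    (Finset.single_le_sum (f := fun i => (μ (A i)).toReal * youngCompl Ψ (z i))
      (fun j _ => mul_nonneg ENNReal.toReal_nonneg (hΨc.nonneg _)) hi).trans hz1
  have hpair : ∀ i, ENNReal.ofReal ((μ (A i)).toReal * ((a i).toReal * (z i / k))) =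
      ENNReal.ofReal (z i / k) * ∫⁻ x in A i, ‖u x * f x‖ₑ ∂μ := by
    intro i
    rw [← haint, ENNReal.ofReal_mul ENNReal.toReal_nonneg, ENNReal.ofReal_mul ENNReal.toReal_nonneg,
      ENNReal.ofReal_toReal (hAfin i), ENNReal.ofReal_toReal (hafin i)]
    ring
  have hzk : ∀ i, 0 ≤ z i / k := fun i => div_nonneg (hz i) hk.le
  have hmain : ∑ i ∈ s, (μ (A i)).toReal * ((a i).toReal * (z i / k)) ≤ 1 + c * D := by
    rw [← ENNReal.ofReal_le_ofReal_iff hC.le, ENNReal.ofReal_sum_of_nonneg fun i _ =>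
      mul_nonneg ENNReal.toReal_nonneg (mul_nonneg ENNReal.toReal_nonneg (hzk i))]
    simp_rw [hpair]
    calc ∑ i ∈ s, ENNReal.ofReal (z i / k) * ∫⁻ x in A i, ‖u x * f x‖ₑ ∂μ
        ≤ ∑ i ∈ s, ((∫⁻ x in A i, ENNReal.ofReal (Φ (k⁻¹ * ‖f x‖)) ∂μ) +
            ENNReal.ofReal (c * (D * ((μ (A i)).toReal * youngCompl Ψ (z i))))) := by
          refine Finset.sum_le_sum fun i hi =>
            (setLIntegral_mul_le hΦ hΦc hu f hk (hz i) (A i)).trans ?_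
          gcongr
          rw [ENNReal.ofReal_mul hc.le]
          refine (hΔ' i (hz i)).trans ?_
          gcongr
          exact hA i _ (hz i) (hz1' i hi)
      _ = (∑ i ∈ s, ∫⁻ x in A i, ENNReal.ofReal (Φ (k⁻¹ * ‖f x‖)) ∂μ) +
            ENNReal.ofReal (c * D * ∑ i ∈ s, (μ (A i)).toReal * youngCompl Ψ (z i)) := by
          rw [Finset.sum_add_distrib, Finset.mul_sum, ENNReal.ofReal_sum_of_nonneg fun i _ =>
            mul_nonneg (by positivity) (mul_nonneg ENNReal.toReal_nonneg (hΨc.nonneg _))]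
          simp_rw [mul_assoc]
      _ ≤ 1 + ENNReal.ofReal (c * D) := by
          refine add_le_add ?_ (ENNReal.ofReal_le_ofReal
            (mul_le_of_le_one_right (by positivity) hz1))
          rw [← lintegral_biUnion_finset
            (fun i _ j _ hij => hAB.pairwise_disjoint hij) fun i _ => hmA i]
          exact hle1 _
      _ = ENNReal.ofReal (1 + c * D) := by
          rw [ENNReal.ofReal_add zero_le_one (by positivity), ENNReal.ofReal_one]
  have hfin : ∑ i ∈ s, (μ (A i)).toReal * (X i * z i) =
      (1 + c * D)⁻¹ * ∑ i ∈ s, (μ (A i)).toReal * ((a i).toReal * (z i / k)) := by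
    rw [Finset.mul_sum]
    refine Finset.sum_congr rfl fun i _ => ?_
    rw [hX]
    field_simp
  rw [hfin]
  exact (inv_mul_le_one₀ hC).2 hmain

end Sufficiency

/-! ### Necessity -/

section Necessity

variable {Ω : Type*} {m mΩ : MeasurableSpace Ω} {μ : Measure Ω} {Φ Ψ : ℝ → ℝ} {u : Ω → ℂ}

/-- The dual estimate on a truncated set. The test function `f` turns `u f` into `|u| g`, where `g`
is the equality case of Young's inequality for `|u| y / C`; on `S` the weight `u` is bounded by `N`,
so that the modular of `f` is finite. -/
lemma WCTBounded.setLIntegral_inter_le (hm : m ≤ mΩ) [SigmaFinite (μ.trim hm)]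
    (hΦ : IsYoung Φ) (hΨ : IsYoung Ψ)
    (hΦc : IsYoung (youngCompl Φ)) (hΨc : IsYoung (youngCompl Ψ)) (hu : Measurable u) {C : ℝ}
    (hC : 0 < C) (h : WCTBounded Φ Ψ m μ u)
    (hnorm : ∀ f ∈ orlicz Φ μ, ∀ σ : ℝ, 0 < σ → modular Φ μ σ⁻¹ f ≤ 1 →
      ∃ k : ℝ, 0 < k ∧ 2 * k ≤ C * σ ∧ modular Ψ μ k⁻¹ (wct m μ u f) ≤ 1)
    {A : Set Ω} (hA : MeasurableSet[m] A) (hfin : μ A ≠ ∞) {y : ℝ} (hy : 0 ≤ y)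
    (hyA : ENNReal.ofReal (youngCompl Ψ y) * μ A ≤ 1) (N : ℝ) :
    ∫⁻ x in A ∩ {x | ‖u x‖ ≤ N}, ENNReal.ofReal (youngCompl Φ (‖u x‖ * y / C)) ∂μ ≤ 1 := by
  obtain ⟨g, hgmono, hg0, hg⟩ := hΦ.exists_monotone_eq
  set S := A ∩ {x | ‖u x‖ ≤ N} with hS
  have hmS : MeasurableSet S := (hm _ hA).inter (measurableSet_le hu.norm measurable_const)
  set w : Ω → ℝ := fun x => ‖u x‖ * y / C with hw
  have hw0 : ∀ x, 0 ≤ w x := fun x => by positivity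
  have hmw : Measurable w := (hu.norm.mul_const y).div_const C
  have hmgw : Measurable fun x => g (w x) := hgmono.measurable.comp hmw
  set G : Ω → ℝ := S.indicator fun x => g (w x) with hG
  have hG0 : ∀ x, 0 ≤ G x := fun x => indicator_nonneg (fun x _ => hg0 _) x
  have hmG : Measurable G := hmgw.indicator hmS
  set f : Ω → ℂ := fun x => (G x : ℂ) * ((starRingEnd ℂ) (u x) / ‖u x‖) with hf
  have hmf : Measurable f := by
    refine (Complex.measurable_ofReal.comp hmG).mul (Measurable.div ?_ ?_)
    · exact Complex.continuous_conj.measurable.comp hu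
    · exact Complex.measurable_ofReal.comp hu.norm
  have huf : ∀ x, u x * f x = ((‖u x‖ * G x : ℝ) : ℂ) := by
    intro x
    rcases eq_or_ne (u x) 0 with h0 | h0
    · simp [h0]
    · have h1 : (‖u x‖ : ℂ) ≠ 0 := by simpa using h0
      have h2 : u x * (starRingEnd ℂ) (u x) = (‖u x‖ : ℂ) ^ 2 := Complex.mul_conj' _
      calc u x * f x = (u x * (starRingEnd ℂ) (u x)) * G x / ‖u x‖ := by rw [hf]; ring
        _ = _ := by rw [h2]; push_cast; field_simp
  have hfG : ∀ x, ‖f x‖ ≤ G x := by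
    intro x
    rw [hf, norm_mul, norm_div, RCLike.norm_conj, Complex.norm_of_nonneg (hG0 x),
      Complex.norm_of_nonneg (norm_nonneg _)]
    exact mul_le_of_le_one_right (hG0 x) (div_self_le_one _)
  have hmod1 : modular Φ μ 1 f ≤ ∫⁻ x in S, ENNReal.ofReal (Φ (g (w x))) ∂μ := by
    rw [modular, ← lintegral_indicator hmS]
    refine lintegral_mono fun x => ?_
    rw [one_mul]
    refine (ENNReal.ofReal_le_ofReal (hΦ.mono (norm_nonneg _) (hfG x))).trans ?_
    by_cases hx : x ∈ S
    · simp [hG, hx]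
    · simp [hG, hx, hΦ.map_zero]
  set I := ∫⁻ x in S, ENNReal.ofReal (Φ (g (w x))) ∂μ with hI
  have hIfin : I ≠ ∞ := by
    refine ((setLIntegral_mono' (g := fun _ => ENNReal.ofReal (Φ (g (N * y / C)))) hmS
      fun x hx => ENNReal.ofReal_le_ofReal (hΦ.mono (hg0 _) (hgmono ?_))).trans_lt ?_).ne
    · have hxN : ‖u x‖ ≤ N := hx.2
      simp only [hw]
      gcongr
    · rw [setLIntegral_const]
      exact ENNReal.mul_lt_top ENNReal.ofReal_lt_top
        ((measure_mono inter_subset_left).trans_lt hfin.lt_top)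
  have hmodfin : modular Φ μ 1 f ≠ ∞ := (hmod1.trans_lt hIfin.lt_top).ne
  have hfo : f ∈ orlicz Φ μ := ⟨hmf, 1, one_pos, hmodfin.lt_top⟩
  set σ := max 1 I.toReal with hσ
  have hσ0 : 0 < σ := lt_max_of_lt_left one_pos
  have hmodσ : modular Φ μ σ⁻¹ f ≤ 1 := by
    rw [← mul_one σ⁻¹]
    refine (modular_mul_le hΦ (inv_nonneg.2 hσ0.le)
      (inv_le_one_of_one_le₀ (le_max_left _ _)) 1).trans ?_
    calc ENNReal.ofReal σ⁻¹ * modular Φ μ 1 f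
        ≤ ENNReal.ofReal σ⁻¹ * ENNReal.ofReal σ := by
          gcongr
          refine hmod1.trans ?_
          rw [← ENNReal.ofReal_toReal hIfin]
          exact ENNReal.ofReal_le_ofReal (le_max_right _ _)
      _ = 1 := by
          rw [← ENNReal.ofReal_mul (inv_nonneg.2 hσ0.le), inv_mul_cancel₀ hσ0.ne',
            ENNReal.ofReal_one]
  obtain ⟨k, hk, hkC, hmodk⟩ := hnorm f hfo σ hσ0 hmodσ
  have hwct : ∀ᵐ x ∂μ, ENNReal.ofReal ‖wct m μ u f x‖ =
      condLExp m μ (fun x => ‖u x * f x‖ₑ) x := by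
    filter_upwards [(h.1 f hfo).1] with x hx
    rw [norm_wct_of_nonneg (fun x => mul_nonneg (norm_nonneg _) (hG0 x)) huf,
      ENNReal.ofReal_toReal hx.ne]
  -- Young's inequality on the side of `Ψ` bounds the pairing of `E(u f)` with `y 1_A`.
  have hupper : ENNReal.ofReal (k⁻¹ * y) * ∫⁻ x in A, ‖u x * f x‖ₑ ∂μ ≤ 2 := by
    rw [← setLIntegral_condLExp hm μ _ hA, ← lintegral_const_mul' _ _ ENNReal.ofReal_ne_top]
    calc ∫⁻ x in A, ENNReal.ofReal (k⁻¹ * y) * condLExp m μ (fun x => ‖u x * f x‖ₑ) x ∂μ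
        ≤ ∫⁻ x in A, (ENNReal.ofReal (Ψ (k⁻¹ * ‖wct m μ u f x‖)) +
            ENNReal.ofReal (youngCompl Ψ y)) ∂μ := by
          refine lintegral_mono_ae ?_
          filter_upwards [ae_restrict_of_ae hwct] with x hx
          rw [← hx, ← ENNReal.ofReal_mul (by positivity),
            ← ENNReal.ofReal_add (hΨ.nonneg _) (hΨc.nonneg _)]
          refine ENNReal.ofReal_le_ofReal (le_trans (le_of_eq ?_)
            (hΨ.mul_le_add (x := k⁻¹ * ‖wct m μ u f x‖) (by positivity) hy))
          ring
      _ ≤ 1 + 1 := by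
          rw [lintegral_add_right _ measurable_const, setLIntegral_const]
          exact add_le_add ((setLIntegral_le_lintegral _ _).trans hmodk) hyA
      _ = 2 := one_add_one_eq_two
  -- The same pairing, computed with the equality case of Young's inequality on the side of `Φ`.
  have hlower : ENNReal.ofReal y * ∫⁻ x in A, ‖u x * f x‖ₑ ∂μ =
      ENNReal.ofReal C * (I + ∫⁻ x in S, ENNReal.ofReal (youngCompl Φ (w x)) ∂μ) := by
    rw [hI, ← lintegral_add_right _ (hΦc.measurable_ofReal hmw),
      ← lintegral_const_mul' _ _ ENNReal.ofReal_ne_top,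
      ← lintegral_const_mul' _ _ ENNReal.ofReal_ne_top, ← lintegral_indicator hmS,
      ← lintegral_indicator (hm _ hA)]
    refine lintegral_congr fun x => ?_
    by_cases hx : x ∈ S
    · rw [indicator_of_mem hx, indicator_of_mem hx.1, ← ENNReal.ofReal_add (hΦ.nonneg _)
        (hΦc.nonneg _), hg _ (hw0 x), huf, ← ofReal_norm, Complex.norm_of_nonneg
        (mul_nonneg (norm_nonneg _) (hG0 x)), ← ENNReal.ofReal_mul hy, ← ENNReal.ofReal_mul hC.le,
        hG, indicator_of_mem hx]
      congr 1
      simp only [hw]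
      field_simp
    · rw [indicator_of_notMem hx]
      by_cases hxA : x ∈ A
      · rw [indicator_of_mem hxA, huf, hG, indicator_of_notMem hx]
        simp
      · rw [indicator_of_notMem hxA]
  have hsum : I + ∫⁻ x in S, ENNReal.ofReal (youngCompl Φ (w x)) ∂μ ≤ ENNReal.ofReal σ := by
    have hC' : ENNReal.ofReal C ≠ 0 := by simpa using hC
    rw [← ENNReal.mul_le_mul_iff_right hC' ENNReal.ofReal_ne_top, ← hlower,
      ← ENNReal.ofReal_mul hC.le]
    have h1 : ENNReal.ofReal y = ENNReal.ofReal k * ENNReal.ofReal (k⁻¹ * y) := by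
      rw [← ENNReal.ofReal_mul hk.le, mul_inv_cancel_left₀ hk.ne']
    rw [h1, mul_assoc]
    calc ENNReal.ofReal k * (ENNReal.ofReal (k⁻¹ * y) * ∫⁻ x in A, ‖u x * f x‖ₑ ∂μ)
        ≤ ENNReal.ofReal k * 2 := by gcongr
      _ = ENNReal.ofReal (2 * k) := by
          rw [mul_comm, ENNReal.ofReal_mul zero_le_two, ENNReal.ofReal_ofNat]
      _ ≤ ENNReal.ofReal (C * σ) := ENNReal.ofReal_le_ofReal hkC
  rcases le_total I.toReal 1 with hI1 | hI1
  · rw [hσ, max_eq_left hI1, ENNReal.ofReal_one] at hsum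
    exact le_add_self.trans hsum
  · rw [hσ, max_eq_right hI1, ENNReal.ofReal_toReal hIfin] at hsum
    have h0 : ∫⁻ x in S, ENNReal.ofReal (youngCompl Φ (w x)) ∂μ ≤ 0 :=
      (ENNReal.add_le_add_iff_left hIfin).1 (by simpa using hsum)
    exact h0.trans zero_le_one

/-- Boundedness of `R_u` makes multiplication by `|u|` bounded on indicator functions, as a map
between the spaces of the complementary functions. -/
lemma WCTBounded.exists_setLIntegral_le (hm : m ≤ mΩ) [SigmaFinite (μ.trim hm)]
    (hΦ : IsYoung Φ) (hΨ : IsYoung Ψ)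
    (hΦc : IsYoung (youngCompl Φ)) (hΨc : IsYoung (youngCompl Ψ)) (hu : Measurable u)
    (h : WCTBounded Φ Ψ m μ u) :
    ∃ C : ℝ, 0 < C ∧ ∀ A, MeasurableSet[m] A → μ A ≠ ∞ → ∀ y, 0 ≤ y →
      ENNReal.ofReal (youngCompl Ψ y) * μ A ≤ 1 →
      ∫⁻ x in A, ENNReal.ofReal (youngCompl Φ (‖u x‖ * y / C)) ∂μ ≤ 1 := by
  obtain ⟨C₀, hC₀⟩ := h.2
  have hC : 0 < 2 * ((C₀ : ℝ) + 1) := by positivity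
  refine ⟨2 * (C₀ + 1), hC, fun A hA hfin y hy hyA => ?_⟩
  have hcov : A = ⋃ n : ℕ, A ∩ {x | ‖u x‖ ≤ n} := by
    rw [← inter_iUnion]
    refine (inter_eq_left.2 fun x _ => ?_).symm
    exact mem_iUnion.2 (exists_nat_ge ‖u x‖)
  have hmono : Monotone fun n : ℕ => A ∩ {x | ‖u x‖ ≤ n} := fun i j hij x hx =>
    ⟨hx.1, le_trans (α := ℝ) hx.2 (Nat.cast_le.2 hij)⟩
  rw [hcov, setLIntegral_iUnion_of_directed _ hmono.directed_le]
  refine iSup_le fun n => h.setLIntegral_inter_le hm hΦ hΨ hΦc hΨc hu hC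
    (fun f hf σ hσ hfσ => ?_) hA hfin hy hyA n
  have h1 : luxNorm Ψ μ (wct m μ u f) < ENNReal.ofReal ((C₀ + 1) * σ) := by
    calc luxNorm Ψ μ (wct m μ u f) ≤ C₀ * luxNorm Φ μ f := hC₀ f hf
      _ ≤ C₀ * ENNReal.ofReal σ := by gcongr; exact luxNorm_le hσ hfσ
      _ = ENNReal.ofReal (C₀ * σ) := by
          rw [ENNReal.ofReal_mul C₀.coe_nonneg, ENNReal.ofReal_coe_nnreal]
      _ < ENNReal.ofReal ((C₀ + 1) * σ) := by
          rw [ENNReal.ofReal_lt_ofReal_iff (by positivity)]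
          linarith
  obtain ⟨k, hk, hfk, hlt⟩ := exists_of_luxNorm_lt h1
  rw [ENNReal.ofReal_lt_ofReal_iff (by positivity)] at hlt
  exact ⟨k, hk, by linarith, hfk⟩

/-- The weighted estimate on sets of the sub-σ-algebra: the condition `∇'` pulls the factor
`Φ*(Ψ*⁻¹(1 / μ A))` out of the integral. -/
theorem WCTBounded.exists_setLIntegral_mul_le (hm : m ≤ mΩ) [SigmaFinite (μ.trim hm)]
    (hΦ : IsYoung Φ) (hΨ : IsYoung Ψ)
    (hΦc : IsYoung (youngCompl Φ)) (hΨc : IsYoung (youngCompl Ψ)) (hu : Measurable u)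
    (h : WCTBounded Φ Ψ m μ u) (hnabla : NablaPrime (youngCompl Φ)) :
    ∃ D : ℝ, 0 ≤ D ∧ ∀ A, MeasurableSet[m] A → μ A ≠ 0 → μ A ≠ ∞ →
      (∫⁻ x in A, ENNReal.ofReal (youngCompl Φ ‖u x‖) ∂μ) *
        ENNReal.ofReal (youngCompl Φ (youngInv (youngCompl Ψ) (1 / (μ A).toReal))) ≤
      ENNReal.ofReal D := by
  obtain ⟨C, hC, hmain⟩ := h.exists_setLIntegral_le hm hΦ hΨ hΦc hΨc hu
  obtain ⟨b, hb, hnabla⟩ := hnabla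
  set e := youngCompl Φ (b ^ 2 * C)⁻¹ with he
  have he0 : 0 < e := hΦc.pos (by positivity)
  refine ⟨e⁻¹, by positivity, fun A hA h0 hfin => ?_⟩
  have hμ : 0 < (μ A).toReal := ENNReal.toReal_pos h0 hfin
  set y := youngInv (youngCompl Ψ) (1 / (μ A).toReal)
  have hy : 0 ≤ y := hΨc.youngInv_nonneg (by positivity)
  have hyA : ENNReal.ofReal (youngCompl Ψ y) * μ A ≤ 1 := by
    rw [hΨc.apply_youngInv (by positivity), ← ENNReal.ofReal_toReal hfin,
      ← ENNReal.ofReal_mul (by positivity), ENNReal.toReal_ofReal hμ.le, one_div_mul_cancel hμ.ne',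
      ENNReal.ofReal_one]
  have hpt : ∀ x, youngCompl Φ ‖u x‖ * youngCompl Φ y ≤
      e⁻¹ * youngCompl Φ (‖u x‖ * y / C) := by
    intro x
    have h1 := hnabla y (b ^ 2 * C)⁻¹ hy (by positivity)
    have h2 := hnabla ‖u x‖ (b * y * (b ^ 2 * C)⁻¹) (norm_nonneg _) (by positivity)
    have h3 : b * ‖u x‖ * (b * y * (b ^ 2 * C)⁻¹) = ‖u x‖ * y / C := by field_simp
    rw [h3] at h2
    rw [inv_mul_eq_div, le_div_iff₀ he0]
    calc youngCompl Φ ‖u x‖ * youngCompl Φ y * e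
        = youngCompl Φ ‖u x‖ * (youngCompl Φ y * e) := by ring
      _ ≤ youngCompl Φ ‖u x‖ * youngCompl Φ (b * y * (b ^ 2 * C)⁻¹) :=
          mul_le_mul_of_nonneg_left h1 (hΦc.nonneg _)
      _ ≤ _ := h2
  rw [← lintegral_mul_const' _ _ ENNReal.ofReal_ne_top]
  calc ∫⁻ x in A, ENNReal.ofReal (youngCompl Φ ‖u x‖) * ENNReal.ofReal (youngCompl Φ y) ∂μ
      ≤ ∫⁻ x in A, ENNReal.ofReal e⁻¹ * ENNReal.ofReal (youngCompl Φ (‖u x‖ * y / C)) ∂μ := by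
        refine lintegral_mono fun x => ?_
        rw [← ENNReal.ofReal_mul (hΦc.nonneg _), ← ENNReal.ofReal_mul (by positivity)]
        exact ENNReal.ofReal_le_ofReal (hpt x)
    _ ≤ ENNReal.ofReal e⁻¹ * 1 := by
        rw [lintegral_const_mul' _ _ ENNReal.ofReal_ne_top]
        gcongr
        exact hmain A hA hfin y hy hyA
    _ = ENNReal.ofReal e⁻¹ := mul_one _

/-- A set of positive finite measure without atoms has subsets of arbitrarily small positive
measure. -/
lemma exists_subset_measure_lt (hm : m ≤ mΩ) {F : Set Ω} (hF : MeasurableSet[m] F)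
    (h0 : μ F ≠ 0) (hfin : μ F ≠ ∞) (hna : ∀ G, G ⊆ F → ¬ IsAtomOf m μ G) {δ : ℝ≥0∞}
    (hδ : δ ≠ 0) : ∃ G, G ⊆ F ∧ MeasurableSet[m] G ∧ μ G ≠ 0 ∧ μ G < δ := by
  have key : ∀ n : ℕ, ∃ G, G ⊆ F ∧ MeasurableSet[m] G ∧ μ G ≠ 0 ∧ μ G ≤ 2⁻¹ ^ n * μ F := by
    intro n
    induction n with
    | zero => exact ⟨F, subset_rfl, hF, h0, by simp⟩
    | succ n ih =>
      obtain ⟨G, hGF, hG, hG0, hGn⟩ := ih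
      have hGfin : μ G ≠ ∞ := ((measure_mono hGF).trans_lt hfin.lt_top).ne
      obtain ⟨H, hH, hHG, hH0, hHne⟩ : ∃ H, MeasurableSet[m] H ∧ H ⊆ G ∧ μ H ≠ 0 ∧ μ H ≠ μ G := by
        by_contra! hall
        refine hna G hGF ⟨hG, pos_iff_ne_zero.2 hG0, fun H hH hHG => ?_⟩
        by_cases h : μ H = 0
        · exact Or.inl h
        · exact Or.inr (hall H hH hHG h)
      have hadd : μ H + μ (G \ H) = μ G := by
        have h1 := measure_inter_add_sdiff (μ := μ) G (hm _ hH)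
        rwa [inter_eq_right.2 hHG] at h1
      have hd0 : μ (G \ H) ≠ 0 := fun h => hHne (by rw [← hadd, h, add_zero])
      have hhalf : 2⁻¹ * μ G ≤ 2⁻¹ ^ (n + 1) * μ F := by
        rw [pow_succ', mul_assoc]
        gcongr
      rcases le_or_gt (μ H) (2⁻¹ * μ G) with hle | hlt
      · exact ⟨H, hHG.trans hGF, hH, hH0, hle.trans hhalf⟩
      · refine ⟨G \ H, sdiff_subset.trans hGF, hG.diff hH, hd0, le_trans ?_ hhalf⟩
        by_contra! hlt'
        have h2 := ENNReal.add_lt_add hlt hlt'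
        rw [hadd, ← add_mul, ENNReal.inv_two_add_inv_two, one_mul] at h2
        exact h2.false
  have hlim : Tendsto (fun n : ℕ => (2⁻¹ : ℝ≥0∞) ^ n * μ F) atTop (nhds 0) := by
    have h1 := ENNReal.Tendsto.mul_const
      (ENNReal.tendsto_pow_atTop_nhds_zero_of_lt_one ENNReal.one_half_lt_one) (b := μ F)
      (Or.inr hfin)
    simpa using h1
  obtain ⟨n, hn⟩ := (hlim.eventually_lt_const (pos_iff_ne_zero.2 hδ)).exists
  obtain ⟨G, hGF, hG, hG0, hGn⟩ := key n
  exact ⟨G, hGF, hG, hG0, hGn.trans_lt hn⟩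

/-- If a density `M` satisfies `∫_A M ≤ D / K(1 / μ A)` with `K` superlinear, its integral over small
sets is `o(μ A)`, so it vanishes where the measure has no atoms. -/
lemma ae_eq_zero_of_setLIntegral_mul_le (hm : m ≤ mΩ) [SigmaFinite (μ.trim hm)] {B : Set Ω}
    (hB : MeasurableSet[m] B) (hna : ∀ F, F ⊆ B → ¬ IsAtomOf m μ F) {M : Ω → ℝ≥0∞}
    (hM : Measurable[m] M) {K : ℝ → ℝ} (hK : Tendsto (fun t => K t / t) atTop atTop) {D : ℝ}
    (hD : 0 ≤ D)
    (h : ∀ A, MeasurableSet[m] A → μ A ≠ 0 → μ A ≠ ∞ →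
      (∫⁻ x in A, M x ∂μ) * ENNReal.ofReal (K (1 / (μ A).toReal)) ≤ ENNReal.ofReal D) :
    ∀ᵐ x ∂μ, x ∈ B → M x = 0 := by
  let ε : ℕ → ℝ := fun n => 1 / ((n : ℝ) + 1)
  have hε : ∀ n, 0 < ε n := fun n => Nat.one_div_pos_of_nat
  let F : ℕ → ℕ → Set Ω := fun n l =>
    B ∩ {x | ENNReal.ofReal (ε n) ≤ M x} ∩ spanningSets (μ.trim hm) l
  have hmF : ∀ n l, MeasurableSet[m] (F n l) := fun n l =>
    (hB.inter (hM measurableSet_Ici)).inter (measurableSet_spanningSets (μ.trim hm) l)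
  have hnull : ∀ n l, μ (F n l) = 0 := by
    intro n l
    by_contra hpos
    have hfin : μ (F n l) ≠ ∞ := by
      refine ((measure_mono inter_subset_right).trans_lt ?_).ne
      rw [← trim_measurableSet_eq hm (measurableSet_spanningSets _ l)]
      exact measure_spanningSets_lt_top _ l
    obtain ⟨t₀, ht₀⟩ := eventually_atTop.1 (hK.eventually_gt_atTop (D / ε n))
    obtain ⟨G, hGF, hG, hG0, hGlt⟩ := exists_subset_measure_lt hm (hmF n l) hpos hfin
      (fun G hGF => hna G (hGF.trans (inter_subset_left.trans inter_subset_left)))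
      (δ := ENNReal.ofReal (1 / max t₀ 1)) (by
        rw [ne_eq, ENNReal.ofReal_eq_zero, not_le]
        positivity)
    have hGfin : μ G ≠ ∞ := (hGlt.trans ENNReal.ofReal_lt_top).ne
    have hμ : 0 < (μ G).toReal := ENNReal.toReal_pos hG0 hGfin
    have hle : t₀ ≤ 1 / (μ G).toReal := by
      have h1 : (μ G).toReal < 1 / max t₀ 1 := by
        rwa [← ENNReal.lt_ofReal_iff_toReal_lt hGfin]
      exact (le_max_left _ _).trans ((lt_one_div hμ (by positivity)).1 h1).le
    have hbig := ht₀ _ hle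
    have hlow : ENNReal.ofReal (ε n * (μ G).toReal) ≤ ∫⁻ x in G, M x ∂μ := by
      rw [ENNReal.ofReal_mul (hε n).le, ENNReal.ofReal_toReal hGfin, ← setLIntegral_const]
      exact setLIntegral_mono' (hm _ hG) fun x hx => (hGF hx).1.2
    have h2 : ENNReal.ofReal (ε n * (μ G).toReal * K (1 / (μ G).toReal)) ≤ ENNReal.ofReal D := by
      rw [ENNReal.ofReal_mul (mul_nonneg (hε n).le hμ.le)]
      exact (mul_le_mul_left hlow _).trans (h G hG hG0 hGfin)
    rw [ENNReal.ofReal_le_ofReal_iff hD] at h2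
    rw [div_lt_iff₀ (hε n), div_div_eq_mul_div, div_one] at hbig
    nlinarith
  have hall : ∀ᵐ x ∂μ, ∀ n l, x ∉ F n l :=
    ae_all_iff.2 fun n => ae_all_iff.2 fun l => measure_eq_zero_iff_ae_notMem.1 (hnull n l)
  filter_upwards [hall] with x hx hxB
  by_contra hne
  obtain ⟨l, hl⟩ : ∃ l, x ∈ spanningSets (μ.trim hm) l :=
    mem_iUnion.1 (iUnion_spanningSets (μ.trim hm) ▸ mem_univ x)
  obtain ⟨n, hn⟩ : ∃ n, ENNReal.ofReal (ε n) ≤ M x := by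
    rcases eq_or_ne (M x) ∞ with htop | htop
    · exact ⟨0, htop ▸ le_top⟩
    · obtain ⟨n, hn⟩ := exists_nat_one_div_lt (ENNReal.toReal_pos hne htop)
      exact ⟨n, (ENNReal.ofReal_le_iff_le_toReal htop).2 hn.le⟩
  exact hx n l ⟨⟨hxB, hn⟩, hl⟩

end Necessity

/-! ### The growth conditions on an atom -/

/-- A bound `J * v ≤ S` on the weight `J` of an atom, combined with a real inequality
`w ≤ q * r * v`, yields the estimate required by `wctBounded_of_atom_le`. -/
lemma mul_ofReal_le_of_le {J S : ℝ≥0∞} (hS : S ≠ ∞) {v w r q : ℝ}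
    (hJ : J * ENNReal.ofReal v ≤ S) (hw : w ≤ q * r * v) (hq : 0 ≤ q) (hr : 0 ≤ r) :
    J * ENNReal.ofReal w ≤ ENNReal.ofReal (S.toReal * q * r) := by
  calc J * ENNReal.ofReal w ≤ J * ENNReal.ofReal (q * r * v) := by gcongr
    _ = ENNReal.ofReal (q * r) * (J * ENNReal.ofReal v) := by
        rw [ENNReal.ofReal_mul (mul_nonneg hq hr)]
        ring
    _ ≤ ENNReal.ofReal (q * r) * S := by gcongr
    _ = ENNReal.ofReal (S.toReal * q * r) := by
        rw [← ENNReal.ofReal_toReal hS, ← ENNReal.ofReal_mul (mul_nonneg hq hr),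
          ENNReal.toReal_ofReal ENNReal.toReal_nonneg]
        congr 1
        ring

/-- The dominated function `Φ* ∘ Ψ*⁻¹` in terms of `y = Ψ*⁻¹ t`. -/
lemma apply_le_of_dominated {Ψ Θ : ℝ → ℝ} (hΨc : IsYoung (youngCompl Ψ)) {K : ℝ → ℝ} {a : ℝ}
    (h : ∀ x, 0 ≤ x → (K ∘ youngInv (youngCompl Ψ)) x ≤ Θ (a * x)) {y : ℝ} (hy : 0 ≤ y) :
    K y ≤ Θ (a * youngCompl Ψ y) := by
  have h1 := h _ (hΨc.nonneg y)
  rwa [Function.comp_apply, hΨc.youngInv_apply hy] at h1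

end OrliczWCT

theorem theorem2p3 {Ω : Type*} {mΩ : MeasurableSpace Ω} (μ : Measure[mΩ] Ω) [SigmaFinite μ]
    (m : MeasurableSpace Ω) (hm : m ≤ mΩ) [SigmaFinite (μ.trim hm)]
    {ι : Type*} [Countable ι] (A : ι → Set Ω) (B : Set Ω)
    (hAB : IsAtomicDecomposition m μ A B)
    (Φ Ψ : ℝ → ℝ) (hΦ : IsYoung Φ) (hΨ : IsYoung Ψ)
    (hΦc : IsYoung (youngCompl Φ)) (hΨc : IsYoung (youngCompl Ψ))
    (u : Ω → ℂ) (hu : Measurable[mΩ] u) :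
    -- (a), first case
    ((∃ Θ : ℝ → ℝ, IsYoung Θ ∧
        Dominated (youngCompl Φ ∘ youngInv (youngCompl Ψ)) Θ ∧
        NablaPrime Θ) →
      DeltaPrime (youngCompl Φ) →
      (∀ᵐ x ∂μ, x ∈ B → condModular (youngCompl Φ) m μ u x = 0) →
      (⨆ i, atomValue μ (condModular (youngCompl Φ) m μ u) (A i) *
          μ (A i) /
        ENNReal.ofReal (youngCompl Φ
          (youngInv (youngCompl Ψ) (μ (A i)).toReal))) < ∞ →
      WCTBounded Φ Ψ m μ u) ∧
    -- (a), second case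
    ((∃ Θ : ℝ → ℝ, IsYoung Θ ∧
        Dominated (youngCompl Φ ∘ youngInv (youngCompl Ψ)) Θ) →
      DeltaPrime (youngCompl Φ) →
      DeltaPrime (youngInv (youngCompl Ψ)) →
      (∀ᵐ x ∂μ, x ∈ B → condModular (youngCompl Φ) m μ u x = 0) →
      (⨆ i, atomValue μ (condModular (youngCompl Φ) m μ u) (A i) *
          μ (A i) *
        ENNReal.ofReal (youngCompl Φ
          (youngInv (youngCompl Ψ) (1 / (μ (A i)).toReal)))) < ∞ →
      WCTBounded Φ Ψ m μ u) ∧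
    -- (b)
    (IsYoung (youngCompl Φ ∘ youngInv (youngCompl Ψ)) →
      NablaPrime (youngCompl Φ) →
      WCTBounded Φ Ψ m μ u →
      (∀ᵐ x ∂μ, x ∈ B → condModular (youngCompl Φ) m μ u x = 0) ∧
      (⨆ i, atomValue μ (condModular (youngCompl Φ) m μ u) (A i) *
          μ (A i) *
        ENNReal.ofReal (youngCompl Φ
          (youngInv (youngCompl Ψ) (1 / (μ (A i)).toReal)))) < ∞) := by
  have hAfin : ∀ i, μ (A i) ≠ ∞ := fun i => ((hAB.isAtom i).measure_lt_top hm).ne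
  have hApos : ∀ i, 0 < (μ (A i)).toReal := fun i =>
    ENNReal.toReal_pos (hAB.isAtom i).2.1.ne' (hAfin i)
  have hval : ∀ i, atomValue μ (condModular (youngCompl Φ) m μ u) (A i) * μ (A i) =
      ∫⁻ x in A i, ENNReal.ofReal (youngCompl Φ ‖u x‖) ∂μ := fun i =>
    (hAB.isAtom i).atomValue_condModular_mul hm
  simp only [hval]
  refine ⟨?_, ?_, ?_⟩
  · rintro ⟨Θ, hΘ, ⟨a, ha, hdom⟩, b, hb, hnabla⟩ hΔ hB hsup
    set S := ⨆ i, (∫⁻ x in A i, ENNReal.ofReal (youngCompl Φ ‖u x‖) ∂μ) /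
      ENNReal.ofReal (youngCompl Φ (youngInv (youngCompl Ψ) (μ (A i)).toReal)) with hS
    refine wctBounded_of_atom_le hm hAB hΦ hΨ hΦc hΨc hu hΔ hB (D := S.toReal * Θ (b * a * a))
      (mul_nonneg ENNReal.toReal_nonneg (hΘ.nonneg _)) fun i y hy hy1 => ?_
    set r := (μ (A i)).toReal * youngCompl Ψ y with hr
    have hr0 : 0 ≤ r := mul_nonneg (hApos i).le (hΨc.nonneg y)
    have hinv := hΨc.youngInv_pos (hApos i)
    have hv : 0 < youngCompl Φ (youngInv (youngCompl Ψ) (μ (A i)).toReal) := hΦc.pos hinv.ne'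
    refine mul_ofReal_le_of_le (v := (youngCompl Φ (youngInv (youngCompl Ψ) (μ (A i)).toReal))⁻¹)
      hsup.ne ?_ ?_ (hΘ.nonneg _) hr0
    · rw [ENNReal.ofReal_inv_of_pos hv, ← div_eq_mul_inv]
      exact le_iSup (fun i => (∫⁻ x in A i, ENNReal.ofReal (youngCompl Φ ‖u x‖) ∂μ) /
        ENNReal.ofReal (youngCompl Φ (youngInv (youngCompl Ψ) (μ (A i)).toReal))) i
    · rw [← div_eq_mul_inv, le_div_iff₀ hv]
      calc youngCompl Φ y * youngCompl Φ (youngInv (youngCompl Ψ) (μ (A i)).toReal)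
          ≤ Θ (a * youngCompl Ψ y) * Θ (a * (μ (A i)).toReal) :=
            mul_le_mul (apply_le_of_dominated hΨc hdom hy) (hdom _ (hApos i).le) hv.le
              (hΘ.nonneg _)
        _ ≤ Θ (b * (a * youngCompl Ψ y) * (a * (μ (A i)).toReal)) :=
            hnabla _ _ (mul_nonneg ha (hΨc.nonneg y)) (mul_nonneg ha (hApos i).le)
        _ = Θ (r * (b * a * a)) := by
            congr 1
            rw [hr]
            ring
        _ ≤ r * Θ (b * a * a) := hΘ.map_mul_le hr0 hy1 _
        _ = Θ (b * a * a) * r := mul_comm _ _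
  · rintro ⟨Θ, hΘ, a, ha, hdom⟩ hΔ ⟨c₂, hc₂, hΔinv⟩ hB hsup
    obtain ⟨c₁, hc₁, hΔ₁⟩ := id hΔ
    set S := ⨆ i, (∫⁻ x in A i, ENNReal.ofReal (youngCompl Φ ‖u x‖) ∂μ) *
      ENNReal.ofReal (youngCompl Φ (youngInv (youngCompl Ψ) (1 / (μ (A i)).toReal))) with hS
    set q := c₁ * youngCompl Φ c₂ * c₁ * Θ a with hq
    have hq0 : 0 ≤ q :=
      mul_nonneg (mul_nonneg (mul_nonneg hc₁.le (hΦc.nonneg _)) hc₁.le) (hΘ.nonneg _)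
    refine wctBounded_of_atom_le hm hAB hΦ hΨ hΦc hΨc hu hΔ hB (D := S.toReal * q)
      (mul_nonneg ENNReal.toReal_nonneg hq0) fun i y hy hy1 => ?_
    set r := (μ (A i)).toReal * youngCompl Ψ y with hr
    have hr0 : 0 ≤ r := mul_nonneg (hApos i).le (hΨc.nonneg y)
    have hi0 : 0 ≤ 1 / (μ (A i)).toReal := one_div_nonneg.2 (hApos i).le
    set p := youngInv (youngCompl Ψ) (1 / (μ (A i)).toReal) with hp
    have hp0 : 0 ≤ p := hΨc.youngInv_nonneg hi0
    set z := youngInv (youngCompl Ψ) r with hz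
    have hz0 : 0 ≤ z := hΨc.youngInv_nonneg hr0
    refine mul_ofReal_le_of_le (v := youngCompl Φ p) hsup.ne
      (le_iSup (fun i => (∫⁻ x in A i, ENNReal.ofReal (youngCompl Φ ‖u x‖) ∂μ) *
        ENNReal.ofReal (youngCompl Φ (youngInv (youngCompl Ψ) (1 / (μ (A i)).toReal)))) i) ?_
      hq0 hr0
    -- `Ψ* y = r * (1 / μ (A i))`, so `Δ'` for the inverse separates `r ≤ 1` from the atom.
    have hyle : y ≤ c₂ * (z * p) := by
      have h1 := hΔinv r (1 / (μ (A i)).toReal) hr0 hi0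
      have h2 : r * (1 / (μ (A i)).toReal) = youngCompl Ψ y := by
        rw [hr]
        field_simp [(hApos i).ne']
      rwa [h2, hΨc.youngInv_apply hy] at h1
    have hzΘ : youngCompl Φ z ≤ r * Θ a := by
      refine (hdom r hr0).trans ?_
      rw [mul_comm a r]
      exact hΘ.map_mul_le hr0 hy1 a
    calc youngCompl Φ y ≤ youngCompl Φ (c₂ * (z * p)) := hΦc.mono hy hyle
      _ ≤ c₁ * (youngCompl Φ c₂ * youngCompl Φ (z * p)) :=
          hΔ₁ _ _ hc₂.le (mul_nonneg hz0 hp0)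
      _ ≤ c₁ * (youngCompl Φ c₂ * (c₁ * (youngCompl Φ z * youngCompl Φ p))) :=
          mul_le_mul_of_nonneg_left
            (mul_le_mul_of_nonneg_left (hΔ₁ _ _ hz0 hp0) (hΦc.nonneg _)) hc₁.le
      _ = c₁ * youngCompl Φ c₂ * c₁ * youngCompl Φ p * youngCompl Φ z := by ring
      _ ≤ c₁ * youngCompl Φ c₂ * c₁ * youngCompl Φ p * (r * Θ a) :=
          mul_le_mul_of_nonneg_left hzΘ (mul_nonneg (mul_nonneg (mul_nonneg hc₁.le
            (hΦc.nonneg _)) hc₁.le) (hΦc.nonneg _))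
      _ = q * r * youngCompl Φ p := by
          rw [hq]
          ring
  · intro hK hnabla hbdd
    obtain ⟨D, hD, hmain⟩ := hbdd.exists_setLIntegral_mul_le hm hΦ hΨ hΦc hΨc hu hnabla
    refine ⟨ae_eq_zero_of_setLIntegral_mul_le hm hAB.measurableSet hAB.nonatomic
      (measurable_condLExp m μ _) hK.tendsto_div hD fun F hF hF0 hFfin => ?_, ?_⟩
    · have h1 := setLIntegral_condModular (μ := μ) (u := u) (Φ := youngCompl Φ) hm hF
      rw [h1]
      exact hmain F hF hF0 hFfin
    · exact (iSup_le fun i => hmain (A i) (hAB.isAtom i).1 (hAB.isAtom i).2.1.ne'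
        (hAfin i)).trans_lt ENNReal.ofReal_lt_top
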